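/- Let $\Gamma=(V,E)$ be a finite simple graph, and let $(G_v)_{v\in V}$ and $(H_v)_{v\in V}$ be two families of finite groups. Let $G_\Gamma$ be the graph product of the $G_v$ over $\Gamma$, that is, the quotient of the free product of the groups $G_v$ ($v\in V$) by the normal closure of all commutators $[g,h]$ with $g\in G_u$, $h\in G_v$ and $\{u,v\}\in E$; let $H_\Gamma$ be the graph product of the $H_v$ over the same graph $\Gamma$. For $\Lambda\subseteq V$ let $G_\Lambda\le G_\Gamma$ be the subgroup generated by the images of the vertex groups $G_v$ with $v\in\Lambda$, and define $H_\Lambda\le H_\Gamma$ likewise. A clique is a (possibly empty) set of pairwise adjacent vertices, and a maximal clique is one that is maximal with respect to inclusion. If $G_\Lambda\not\cong H_\Delta$ for all maximal cliques $\Lambda,\Delta$ of $\Gamma$, then $G_\Gamma\not\cong H_\Gamma$. -/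

import Mathlib

universe u v w

namespace GraphProduct

open scoped commutatorElement

/-- The commutators `[g, h]` in the free product of the vertex groups, where `g` and `h` lie in
vertex groups belonging to adjacent vertices. -/
def relators {V : Type u} (Γ : SimpleGraph V) (G : V → Type v) [∀ x, Group (G x)] :
    Set (Monoid.CoprodI G) :=
  {r | ∃ (x y : V) (_ : Γ.Adj x y) (g : G x) (h : G y),
    r = ⁅(Monoid.CoprodI.of g : Monoid.CoprodI G), Monoid.CoprodI.of h⁆}

end GraphProduct

/-- The graph product of the vertex groups `G x` over the simple graph `Γ`: the free product of the
vertex groups modulo the normal closure of the commutators `[g, h]`, for `g` and `h` in vertex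
groups of adjacent vertices. -/
abbrev GraphProduct {V : Type u} (Γ : SimpleGraph V) (G : V → Type v) [∀ x, Group (G x)] :
    Type (max u v) :=
  Monoid.CoprodI G ⧸ Subgroup.normalClosure (GraphProduct.relators Γ G)

namespace GraphProduct

/-- The canonical homomorphism from a vertex group to the graph product. -/
def of {V : Type u} (Γ : SimpleGraph V) (G : V → Type v) [∀ x, Group (G x)] (x : V) :
    G x →* GraphProduct Γ G :=
  (QuotientGroup.mk' (Subgroup.normalClosure (relators Γ G))).comp Monoid.CoprodI.of

/-- The subgroup of the graph product generated by the vertex groups of the vertices in `Λ`. -/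
def vertexSubgroup {V : Type u} (Γ : SimpleGraph V) (G : V → Type v) [∀ x, Group (G x)]
    (Λ : Set V) : Subgroup (GraphProduct Γ G) :=
  ⨆ x ∈ Λ, (of Γ G x).range

end GraphProduct

/-!
Graph products of the `G x` and of the `H x` over a finite graph `Γ` are told apart by the largest
order of a finite subgroup. Two facts are needed.

* For a clique `Λ` the canonical map `∏ x ∈ Λ, G x → G_Λ` is an isomorphism, so `G_Λ` is finite.
* Every finite group `Q` that embeds in `G_Γ` embeds in `G_Λ` for some maximal clique `Λ`
  (`exists_maximal_clique_injective`).

Given an isomorphism `G_Γ ≃* H_Γ`, let `Λ` be a maximal clique for which `G_Λ` has the largest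
order. Then `G_Λ` embeds in some `H_Δ`, which embeds in some `G_Λ'`, which has order at most that
of `G_Λ`. Hence the embedding of `G_Λ` in `H_Δ` is an isomorphism.

The second fact rests on the theorem that an element of finite order in a free product is conjugate
into a factor (`Monoid.CoprodI.eq_one_or_isConj_of_isOfFinOrder`), which is used twice.

First, an element `t` of finite order in the kernel of `G_Γ → ∏ x, G x` is trivial
(`eq_one_of_isOfFinOrder_of_proj_eq_one`). For a vertex `v`, the kernel of the retraction of `G_Γ`
which kills `G v` is a free product of conjugates of `G v`; this is made precise by an embedding of
`G_Γ` into a semidirect product `(∗ G v) ⋊ G_Γ` whose second component is that retraction. Thus if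
the retraction kills `t`, then `t` is conjugate into a copy of `G v`, and it is trivial since its
component at `v` is. Induction on the set of vertices that are not killed does the rest. In
particular a finite `Q ≤ G_Γ` embeds in `∏ x, G x`.

Second, let `S` be a minimal set of vertices such that `Q → ∏ x ∈ S, G x` is injective. Then `S` is
a clique: if `v` and `w` in `S` are distinct and not adjacent, then by minimality there are `a` and
`b` in `Q` whose only nontrivial component in `S` is the one at `v`, respectively at `w`. The image
of `a * b` in the free product `G v ∗ G w` has finite order, so it is conjugate into a factor, and
one of the components of `a * b` at `v` and `w` is trivial, which is absurd.
-/

/-! ### Elements of finite order in free products -/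

namespace Monoid.CoprodI

variable {ι : Type*}

/-- The powers of a reduced word whose first and last letters lie in different factors are
reduced as well. -/
theorem NeWord.exists_prod_eq_pow {M : ι → Type*} [∀ i, Monoid (M i)] {i j : ι}
    (w : NeWord M i j) (hij : i ≠ j) (n : ℕ) : ∃ w' : NeWord M i j, w'.prod = w.prod ^ (n + 1) := by
  induction n with
  | zero => exact ⟨w, by simp⟩
  | succ n ih =>
    obtain ⟨w', h⟩ := ih
    exact ⟨w'.append hij.symm w, by rw [NeWord.append_prod, h, pow_succ _ (n + 1)]⟩

theorem NeWord.prod_ne_one {M : ι → Type*} [∀ i, Monoid (M i)] {i j : ι} (w : NeWord M i j) :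
    w.prod ≠ 1 := by
  classical
  intro h
  have h1 : w.toWord = Word.empty :=
    Word.equiv.symm.injective (show w.toWord.prod = Word.empty.prod by
      rw [Word.prod_empty]; exact h)
  exact w.toList_ne_nil (congrArg Word.toList h1)

theorem NeWord.not_isOfFinOrder_prod {M : ι → Type*} [∀ i, Monoid (M i)] {i j : ι}
    (w : NeWord M i j) (hij : i ≠ j) : ¬ IsOfFinOrder w.prod := by
  rw [isOfFinOrder_iff_pow_eq_one]
  rintro ⟨n, hn, h⟩
  obtain ⟨w', hw'⟩ := w.exists_prod_eq_pow hij (n - 1)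
  rw [Nat.sub_add_cancel hn, h] at hw'
  exact w'.prod_ne_one hw'

/-- An element of finite order in a free product of groups is conjugate into a factor. The
alternative `x = 1` is only needed when there are no factors. -/
theorem eq_one_or_isConj_of_isOfFinOrder {G : ι → Type*} [∀ i, Group (G i)] {x : CoprodI G}
    (hx : IsOfFinOrder x) : x = 1 ∨ ∃ (i : ι) (g : G i), IsConj (of g) x := by
  classical
  -- Induction on the length of the reduced word: if its first and last letters lie in the same
  -- factor, conjugating by the first letter merges it with the last one.
  suffices H : ∀ (n : ℕ) (w : Word G), w.toList.length = n → IsOfFinOrder w.prod →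
      w.prod = 1 ∨ ∃ (i : ι) (g : G i), IsConj (of g) w.prod by
    have hw : (Word.equiv x).prod = x := Word.equiv.symm_apply_apply x
    simpa only [hw] using H _ (Word.equiv x) rfl (by rwa [hw])
  intro n
  induction n using Nat.strong_induction_on with
  | _ n ih =>
  intro w hn hw
  obtain ⟨l, h1, hc⟩ := w
  rcases l with _ | ⟨⟨i, a⟩, l⟩
  · exact Or.inl Word.prod_empty
  rcases l.eq_nil_or_concat' with rfl | ⟨l, ⟨j, b⟩, rfl⟩
  · exact Or.inr ⟨i, a, by simpa [Word.prod] using IsConj.refl (of a)⟩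
  by_cases hij : i = j
  · subst hij
    have key : ∀ w' : Word G, w'.toList.length < n →
        w'.prod = (l.map fun s => of s.2).prod * of (b * a) →
        (⟨⟨i, a⟩ :: (l ++ [⟨i, b⟩]), h1, hc⟩ : Word G).prod = 1 ∨
          ∃ (k : ι) (g : G k), IsConj (of g)
            (⟨⟨i, a⟩ :: (l ++ [⟨i, b⟩]), h1, hc⟩ : Word G).prod := by
      intro w' hlen hprod
      have hconj : (⟨⟨i, a⟩ :: (l ++ [⟨i, b⟩]), h1, hc⟩ : Word G).prod =
          MulAut.conj (of a) w'.prod := by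
        rw [hprod, MulAut.conj_apply]
        simp [Word.prod, mul_assoc]
      rw [hconj] at hw ⊢
      have hw' : IsOfFinOrder w'.prod := 
        (MulEquiv.injective _).isOfFinOrder_iff (f := (MulAut.conj (of a)).toMonoidHom) |>.1 hw
      rcases ih _ hlen w' rfl hw' with h | ⟨k, g, h⟩
      · exact Or.inl (by rw [h, map_one])
      · exact Or.inr ⟨k, g, h.trans (isConj_iff.2 ⟨of a, rfl⟩)⟩
    have hc' : (l ++ [(⟨i, b⟩ : Σ i, G i)]).IsChain fun s t => s.1 ≠ t.1 := hc.tail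
    by_cases hba : b * a = 1
    · refine key ⟨l, fun s hs => h1 s (by simp [hs]), hc'.left_of_append⟩ ?_ ?_
      · simp at hn ⊢; omega
      · simp [Word.prod, hba]
    · refine key ⟨l ++ [⟨i, b * a⟩], ?_, ?_⟩ ?_ ?_
      · intro s hs
        rcases List.mem_append.1 hs with hs | hs
        · exact h1 s (by simp [hs])
        · rw [List.mem_singleton.1 hs]; exact hba
      · rw [List.isChain_append] at hc' ⊢
        refine ⟨hc'.1, List.isChain_singleton _, ?_⟩
        simpa using hc'.2.2
      · simp at hn ⊢; omega
      · simp [Word.prod]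
  · exfalso
    obtain ⟨i', j', w', hw'⟩ := NeWord.of_word
      (⟨⟨i, a⟩ :: (l ++ [⟨j, b⟩]), by simpa using h1, by simpa using hc⟩ : Word G)
      (fun h => by simpa using congrArg Word.toList h)
    have hl : w'.toList = ⟨i, a⟩ :: (l ++ [⟨j, b⟩]) := congrArg Word.toList hw'
    have hi := w'.toList_head?
    have hj := w'.toList_getLast?
    rw [hl] at hi hj
    rw [← List.cons_append, List.getLast?_append] at hj
    simp only [List.head?_cons, Option.some.injEq, Sigma.mk.injEq, List.getLast?_singleton,
      Option.some_or] at hi hj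
    refine w'.not_isOfFinOrder_prod (by rw [← hi.1, ← hj.1]; exact hij) ?_
    have : w'.prod = Word.prod
        ⟨⟨i, a⟩ :: (l ++ [⟨j, b⟩]), by simpa using h1, by simpa using hc⟩ := by
      rw [← hw']; rfl
    rw [this]
    simpa using hw

/-- Permutations of the index set act on a free product of copies of one group. -/
def permAut (ι P : Type*) [Group P] : Equiv.Perm ι →* MulAut (CoprodI fun _ : ι => P) where
  toFun σ := MonoidHom.toMulEquiv
    (lift fun i => of (M := fun _ : ι => P) (i := σ i))
    (lift fun i => of (M := fun _ : ι => P) (i := σ.symm i))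
    (by ext i g; simp) (by ext i g; simp)
  map_one' := by
    apply MulEquiv.toMonoidHom_injective
    ext i g
    simp
  map_mul' σ τ := by
    apply MulEquiv.toMonoidHom_injective
    ext i g
    simp

theorem permAut_of {P : Type*} [Group P] (σ : Equiv.Perm ι) (i : ι) (g : P) :
    permAut ι P σ (of (M := fun _ : ι => P) (i := i) g) =
      of (M := fun _ : ι => P) (i := σ i) g :=
  lift_of _ _

end Monoid.CoprodI

/-! ### Homomorphisms out of graph products -/

namespace GraphProduct

open Monoid

section Lift

variable {V : Type u} {Γ : SimpleGraph V} {G : V → Type v} [∀ x, Group (G x)]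
variable {M : Type*} [Group M]

theorem commute_of {x y : V} (h : Γ.Adj x y) (a : G x) (b : G y) :
    Commute (of Γ G x a) (of Γ G y b) := by
  rw [← commutatorElement_eq_one_iff_commute]
  exact (QuotientGroup.eq_one_iff _).2 (Subgroup.subset_normalClosure ⟨x, y, h, a, b, rfl⟩)

/-- The universal property of the graph product: homomorphisms on the vertex groups whose images
commute for adjacent vertices extend to the graph product. -/
def lift (f : ∀ x, G x →* M)
    (hf : ∀ x y, Γ.Adj x y → ∀ (a : G x) (b : G y), Commute (f x a) (f y b)) :
    GraphProduct Γ G →* M :=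
  QuotientGroup.lift _ (CoprodI.lift f) (by
    refine Subgroup.normalClosure_le_normal ?_
    rintro _ ⟨x, y, h, a, b, rfl⟩
    simpa [MonoidHom.mem_ker, map_commutatorElement, commutatorElement_eq_one_iff_commute]
      using hf x y h a b)

@[simp]
theorem lift_of (f : ∀ x, G x →* M) (hf) (x : V) (a : G x) :
    lift (Γ := Γ) f hf (of Γ G x a) = f x a :=
  CoprodI.lift_of f a

theorem hom_ext {f g : GraphProduct Γ G →* M}
    (h : ∀ x (a : G x), f (of Γ G x a) = g (of Γ G x a)) : f = g := by
  apply QuotientGroup.monoidHom_ext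
  apply CoprodI.ext_hom
  intro x
  ext a
  exact h x a

end Lift

section Retractions

variable {V : Type u} (Γ : SimpleGraph V) (G : V → Type v) [∀ x, Group (G x)]

open Classical in
/-- The retraction of the graph product onto the vertex group at `v`. -/
noncomputable def proj (v : V) : GraphProduct Γ G →* G v :=
  lift (Function.update (fun _ => 1) v (MonoidHom.id (G v))) (by
    intro x y h a b
    rcases eq_or_ne x v with rfl | hx
    · rw [Function.update_of_ne h.ne']
      exact Commute.one_right _
    · rw [Function.update_of_ne hx]
      exact Commute.one_left _)

theorem proj_of_self (v : V) (a : G v) : proj Γ G v (of Γ G v a) = a := by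
  simp [proj]

theorem proj_of_ne {v x : V} (h : x ≠ v) (a : G x) : proj Γ G v (of Γ G x a) = 1 := by
  classical
  rw [proj, lift_of, Function.update_of_ne h]
  rfl

open Classical in
/-- The retraction of the graph product onto the subgroup of the vertex groups in `S`, killing the
other vertex groups, as an endomorphism of the graph product. -/
noncomputable def retract (S : Set V) : GraphProduct Γ G →* GraphProduct Γ G :=
  lift (fun x => if x ∈ S then of Γ G x else 1) (by
    intro x y h a b
    split_ifs
    · exact commute_of h a b
    all_goals simp)

open Classical in
theorem retract_of (S : Set V) (x : V) (a : G x) :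
    retract Γ G S (of Γ G x a) = if x ∈ S then of Γ G x a else 1 := by
  rw [retract, lift_of]
  split_ifs <;> rfl

theorem proj_retract {S : Set V} {v : V} (hv : v ∈ S) (t : GraphProduct Γ G) :
    proj Γ G v (retract Γ G S t) = proj Γ G v t := by
  refine DFunLike.congr_fun (f := (proj Γ G v).comp (retract Γ G S)) (hom_ext fun x a => ?_) t
  rw [MonoidHom.comp_apply, retract_of]
  split_ifs with hx
  · rfl
  · rw [map_one, proj_of_ne _ _ (by rintro rfl; exact hx hv)]

theorem proj_retract_eq_one {t : GraphProduct Γ G} (ht : ∀ x, proj Γ G x t = 1) (S : Set V)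
    (v : V) : proj Γ G v (retract Γ G S t) = 1 := by
  by_cases hv : v ∈ S
  · rw [proj_retract _ _ hv, ht]
  · refine DFunLike.congr_fun (f := (proj Γ G v).comp (retract Γ G S)) (g := 1)
      (hom_ext fun x a => ?_) t
    rw [MonoidHom.comp_apply, retract_of]
    split_ifs with hx
    · exact proj_of_ne _ _ (by rintro rfl; exact hv hx) _
    · exact map_one _

theorem retract_retract (S T : Set V) (t : GraphProduct Γ G) :
    retract Γ G S (retract Γ G T t) = retract Γ G (S ∩ T) t := by
  refine DFunLike.congr_fun (f := (retract Γ G S).comp (retract Γ G T)) (hom_ext fun x a => ?_) t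
  rw [MonoidHom.comp_apply, retract_of, retract_of]
  by_cases hT : x ∈ T <;> by_cases hS : x ∈ S <;> simp [hT, hS, retract_of]

theorem retract_univ (t : GraphProduct Γ G) : retract Γ G Set.univ t = t :=
  DFunLike.congr_fun (g := MonoidHom.id _) (hom_ext fun x a => by simp [retract_of]) t

theorem retract_empty (t : GraphProduct Γ G) : retract Γ G ∅ t = 1 :=
  DFunLike.congr_fun (g := 1) (hom_ext fun x a => by simp [retract_of]) t

end Retractions

/-! ### The semidirect product decomposition at a vertex -/

section Semidirect

variable {V : Type u} (Γ : SimpleGraph V) (G : V → Type v) [∀ x, Group (G x)] (v : V)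

/-- The centralizer of the vertex group at `v`. Its cosets index the conjugates of the vertex group
together with their identifications with `G v`. -/
abbrev cent : Subgroup (GraphProduct Γ G) :=
  Subgroup.centralizer (of Γ G v).range

/-- The free product of copies of `G v` indexed by the cosets of the centralizer of `G v`. -/
abbrev CosetCoprod : Type _ :=
  CoprodI fun _ : GraphProduct Γ G ⧸ cent Γ G v => G v

/-- The graph product acts on `CosetCoprod` by permuting the cosets which index the factors. -/
def cosetAction : GraphProduct Γ G →* MulAut (CosetCoprod Γ G v) :=
  (CoprodI.permAut _ _).comp (MulAction.toPermHom _ _)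

/-- The copy of `G v` in `CosetCoprod` with index `c`. -/
abbrev cosetOf (c : GraphProduct Γ G ⧸ cent Γ G v) : G v →* CosetCoprod Γ G v :=
  CoprodI.of (M := fun _ : GraphProduct Γ G ⧸ cent Γ G v => G v) (i := c)

theorem cosetAction_of (x : GraphProduct Γ G) (c : GraphProduct Γ G ⧸ cent Γ G v) (g : G v) :
    cosetAction Γ G v x (cosetOf Γ G v c g) = cosetOf Γ G v (x • c) g :=
  CoprodI.permAut_of _ _ _

theorem commute_inl_inr {y : V} (h : Γ.Adj v y) (a : G v) (b : G y) :
    Commute (SemidirectProduct.inl (φ := cosetAction Γ G v)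
      (cosetOf Γ G v ((1 : GraphProduct Γ G) : _) a))
      (SemidirectProduct.inr (of Γ G y b)) := by
  have hc : of Γ G y b • (((1 : GraphProduct Γ G) : GraphProduct Γ G ⧸ cent Γ G v)) =
      ((1 : GraphProduct Γ G) : GraphProduct Γ G ⧸ cent Γ G v) := by
    rw [MulAction.Quotient.smul_coe, smul_eq_mul, mul_one, eq_comm, QuotientGroup.eq, inv_one,
      one_mul, Subgroup.mem_centralizer_iff]
    rintro _ ⟨a, rfl⟩
    exact commute_of h a b
  have := SemidirectProduct.inl_aut (φ := cosetAction Γ G v) (of Γ G y b)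
    (cosetOf Γ G v ((1 : GraphProduct Γ G) : _) a)
  rw [cosetAction_of, hc, map_inv, eq_mul_inv_iff_mul_eq] at this
  exact this

open Classical in
/-- The homomorphism to the semidirect product which sends the vertex group at `v` to the factor
indexed by the trivial coset and every other vertex group to the right-hand factor. -/
noncomputable def toSemidirect :
    GraphProduct Γ G →* CosetCoprod Γ G v ⋊[cosetAction Γ G v] GraphProduct Γ G :=
  lift (Function.update (fun x => SemidirectProduct.inr.comp (of Γ G x)) v
      (SemidirectProduct.inl.comp (cosetOf Γ G v ((1 : GraphProduct Γ G) : _)))) (by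
    intro x y h a b
    rcases eq_or_ne x v with rfl | hx
    · rw [Function.update_self, Function.update_of_ne h.ne']
      exact commute_inl_inr Γ G x h a b
    rw [Function.update_of_ne hx]
    rcases eq_or_ne y v with rfl | hy
    · rw [Function.update_self]
      exact (commute_inl_inr Γ G y h.symm b a).symm
    · rw [Function.update_of_ne hy]
      exact (commute_of h a b).map SemidirectProduct.inr)

theorem toSemidirect_of_self (a : G v) :
    toSemidirect Γ G v (of Γ G v a) =
      SemidirectProduct.inl (cosetOf Γ G v ((1 : GraphProduct Γ G) : _) a) := by
  simp [toSemidirect]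

theorem toSemidirect_of_ne {x : V} (hx : x ≠ v) (a : G x) :
    toSemidirect Γ G v (of Γ G x a) = SemidirectProduct.inr (of Γ G x a) := by
  classical
  rw [toSemidirect, lift_of, Function.update_of_ne hx]
  rfl

theorem toSemidirect_right (t : GraphProduct Γ G) :
    (toSemidirect Γ G v t).right = retract Γ G {v}ᶜ t := by
  refine DFunLike.congr_fun (f := SemidirectProduct.rightHom.comp (toSemidirect Γ G v))
    (hom_ext fun x a => ?_) t
  rw [MonoidHom.comp_apply, retract_of]
  rcases eq_or_ne x v with rfl | hx
  · simp [toSemidirect_of_self]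
  · simp [toSemidirect_of_ne _ _ _ hx, hx]

/-- The factor of `CosetCoprod` indexed by `c` is sent to the corresponding conjugate of the vertex
group at `v`. The value does not depend on the representative `c.out` of `c`. -/
noncomputable def ofCosetCoprod : CosetCoprod Γ G v →* GraphProduct Γ G :=
  CoprodI.lift fun c => (MulAut.conj c.out).toMonoidHom.comp (of Γ G v)

theorem ofCosetCoprod_cosetOf (x : GraphProduct Γ G) (a : G v) :
    ofCosetCoprod Γ G v (cosetOf Γ G v (x : GraphProduct Γ G ⧸ cent Γ G v) a) =
      x * of Γ G v a * x⁻¹ := by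
  obtain ⟨⟨l, hl⟩, h⟩ := QuotientGroup.mk_out_eq_mul (cent Γ G v) x
  have hl' := Subgroup.mem_centralizer_iff.1 hl (of Γ G v a) ⟨a, rfl⟩
  rw [ofCosetCoprod, CoprodI.lift_of]
  simp only [h, MonoidHom.comp_apply, MulEquiv.coe_toMonoidHom, MulAut.conj_apply, mul_inv_rev]
  rw [mul_assoc x l, ← hl']
  group

/-- A left inverse of `toSemidirect`. -/
noncomputable def ofSemidirect :
    CosetCoprod Γ G v ⋊[cosetAction Γ G v] GraphProduct Γ G →* GraphProduct Γ G :=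
  SemidirectProduct.lift (ofCosetCoprod Γ G v) (MonoidHom.id _) (by
    intro x
    apply CoprodI.ext_hom
    intro c
    obtain ⟨y, rfl⟩ := QuotientGroup.mk_surjective c
    ext a
    change ofCosetCoprod Γ G v (cosetAction Γ G v x (cosetOf Γ G v _ a)) =
      x * ofCosetCoprod Γ G v (cosetOf Γ G v _ a) * x⁻¹
    rw [cosetAction_of, MulAction.Quotient.smul_coe, ofCosetCoprod_cosetOf, ofCosetCoprod_cosetOf,
      smul_eq_mul]
    group)

theorem toSemidirect_injective : Function.Injective (toSemidirect Γ G v) := by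
  refine Function.LeftInverse.injective (g := ofSemidirect Γ G v) fun t => ?_
  refine DFunLike.congr_fun (f := (ofSemidirect Γ G v).comp (toSemidirect Γ G v))
    (g := MonoidHom.id _) (hom_ext fun x a => ?_) t
  rw [MonoidHom.comp_apply]
  rcases eq_or_ne x v with rfl | hx
  · rw [toSemidirect_of_self, ofSemidirect, SemidirectProduct.lift_inl, ofCosetCoprod_cosetOf]
    simp
  · rw [toSemidirect_of_ne _ _ _ hx, ofSemidirect, SemidirectProduct.lift_inr]

/-- The homomorphism identifying all copies of `G v` recovers the component at `v`. -/
theorem lift_id_toSemidirect_left (t : GraphProduct Γ G) :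
    CoprodI.lift (fun _ => MonoidHom.id (G v)) (toSemidirect Γ G v t).left = proj Γ G v t := by
  let F : CosetCoprod Γ G v ⋊[cosetAction Γ G v] GraphProduct Γ G →* G v :=
    SemidirectProduct.lift (CoprodI.lift fun _ => MonoidHom.id (G v)) 1 (by
      intro x
      apply CoprodI.ext_hom
      intro c
      ext a
      change CoprodI.lift (fun _ => MonoidHom.id (G v))
          (cosetAction Γ G v x (cosetOf Γ G v c a)) =
        1 * CoprodI.lift (fun _ => MonoidHom.id (G v)) (cosetOf Γ G v c a) * 1⁻¹
      rw [cosetAction_of]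
      simp)
  have hF : F.comp (toSemidirect Γ G v) = proj Γ G v := by
    refine hom_ext fun x a => ?_
    rw [MonoidHom.comp_apply]
    rcases eq_or_ne x v with rfl | hx
    · rw [toSemidirect_of_self, proj_of_self, SemidirectProduct.lift_inl]
      simp
    · rw [toSemidirect_of_ne _ _ _ hx, proj_of_ne _ _ hx, SemidirectProduct.lift_inr]
      simp
  rw [← hF, MonoidHom.comp_apply]
  simp [F, SemidirectProduct.lift]

/-- The image of `t` in the semidirect product lies in the free product of copies of `G v`, so it is
conjugate into a copy, on which the component at `v` is injective. -/
theorem eq_one_of_isOfFinOrder_of_retract_compl_eq_one {t : GraphProduct Γ G}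
    (ht : IsOfFinOrder t) (hv : proj Γ G v t = 1) (hr : retract Γ G {v}ᶜ t = 1) : t = 1 := by
  apply toSemidirect_injective Γ G v
  set s := toSemidirect Γ G v t with hs
  have hright : s.right = 1 := by rw [hs, toSemidirect_right, hr]
  have hinl : SemidirectProduct.inl s.left = s := by
    ext <;> simp [hright]
  have hfin : IsOfFinOrder s.left := by
    rw [← SemidirectProduct.inl_injective.isOfFinOrder_iff (f := SemidirectProduct.inl
      (φ := cosetAction Γ G v)), hinl]
    exact (toSemidirect Γ G v).isOfFinOrder ht
  have hleft : CoprodI.lift (fun _ => MonoidHom.id (G v)) s.left = 1 := by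
    rw [hs, lift_id_toSemidirect_left, hv]
  rw [map_one, ← hinl]
  rcases CoprodI.eq_one_or_isConj_of_isOfFinOrder hfin with h | ⟨c, g, h⟩
  · rw [h, map_one]
  · have hg := (CoprodI.lift fun _ => MonoidHom.id (G v)).map_isConj h
    rw [hleft, CoprodI.lift_of, isConj_one_left] at hg
    have hg' : g = 1 := hg
    rw [hg', map_one, isConj_one_right] at h
    rw [h, map_one]

end Semidirect

/-! ### Finite subgroups -/

section Finite

variable {V : Type u} {Γ : SimpleGraph V} {G : V → Type v} [∀ x, Group (G x)]

/-- The kernel of the homomorphism from the graph product over a finite graph to the direct product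
of the vertex groups is torsion-free. -/
theorem eq_one_of_isOfFinOrder_of_proj_eq_one [Finite V] {t : GraphProduct Γ G}
    (ht : IsOfFinOrder t) (hp : ∀ x, proj Γ G x t = 1) : t = 1 := by
  suffices H : ∀ S : Set V, retract Γ G S t = 1 by rw [← retract_univ Γ G t, H]
  intro S
  induction S, S.toFinite using Set.Finite.induction_on with
  | empty => exact retract_empty Γ G t
  | @insert v S hv _ ih =>
    refine eq_one_of_isOfFinOrder_of_retract_compl_eq_one Γ G v
      ((retract Γ G _).isOfFinOrder ht) (proj_retract_eq_one Γ G hp _ _) ?_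
    have hS : {v}ᶜ ∩ insert v S = S := by
      ext x
      by_cases hx : x = v <;> simp [hx, hv]
    rw [retract_retract, hS, ih]

open Classical in
/-- The homomorphism to the free product of the vertex groups which kills all vertex groups except
those of two nonadjacent vertices `v` and `w`. -/
noncomputable def toCoprod {v w : V} (h : ¬ Γ.Adj v w) : GraphProduct Γ G →* CoprodI G :=
  lift (fun x => if x = v ∨ x = w then CoprodI.of else 1) (by
    intro x y hxy a b
    by_cases hx : x = v ∨ x = w
    · have hy : ¬ (y = v ∨ y = w) := by
        rintro (rfl | rfl) <;> rcases hx with rfl | rfl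
        exacts [hxy.ne rfl, h hxy.symm, h hxy, hxy.ne rfl]
      simp [hy]
    · simp [hx])

/-- An element of finite order has a trivial component at one of any two distinct nonadjacent
vertices. -/
theorem proj_eq_one_or_proj_eq_one {v w : V} (hvw : v ≠ w) (h : ¬ Γ.Adj v w)
    {t : GraphProduct Γ G} (ht : IsOfFinOrder t) : proj Γ G v t = 1 ∨ proj Γ G w t = 1 := by
  classical
  have hproj : ∀ z, z = v ∨ z = w → (CoprodI.lift (Pi.mulSingle z (MonoidHom.id (G z))))
      (toCoprod h t) = proj Γ G z t := by
    intro z hz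
    refine DFunLike.congr_fun (f := (CoprodI.lift _).comp (toCoprod h)) (hom_ext fun x a => ?_) t
    rw [MonoidHom.comp_apply, toCoprod, lift_of]
    rcases eq_or_ne x z with rfl | hx
    · rw [if_pos hz, CoprodI.lift_of, proj_of_self, Pi.mulSingle_eq_same]
      rfl
    · rw [proj_of_ne _ _ hx]
      split_ifs
      · rw [CoprodI.lift_of, Pi.mulSingle_eq_of_ne hx]
        rfl
      · simp
  rw [← hproj v (Or.inl rfl), ← hproj w (Or.inr rfl)]
  rcases CoprodI.eq_one_or_isConj_of_isOfFinOrder ((toCoprod h).isOfFinOrder ht) with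
    h1 | ⟨x, g, h1⟩
  · simp [h1]
  · have key : ∀ z, z ≠ x →
        CoprodI.lift (Pi.mulSingle z (MonoidHom.id (G z))) (toCoprod h t) = 1 := by
      intro z hz
      have h2 := (CoprodI.lift (Pi.mulSingle z (MonoidHom.id (G z)))).map_isConj h1
      rw [CoprodI.lift_of, Pi.mulSingle_eq_of_ne hz.symm] at h2
      exact isConj_one_right.1 h2
    by_cases hx : v = x
    · exact Or.inr (key w (hx ▸ hvw.symm))
    · exact Or.inl (key v hx)

/-- A finite group inside the graph product is detected by its components at the vertices of some
clique. -/
theorem exists_isClique_forall_proj_eq_one [Finite V] {Q : Type*} [Group Q] [Finite Q]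
    (φ : Q →* GraphProduct Γ G) (hφ : Function.Injective φ) :
    ∃ S : Set V, Γ.IsClique S ∧ ∀ q, (∀ x ∈ S, proj Γ G x (φ q) = 1) → q = 1 := by
  have hfin (q : Q) : IsOfFinOrder (φ q) := φ.isOfFinOrder (isOfFinOrder_of_finite q)
  obtain ⟨S, hS⟩ := exists_minimal_of_wellFoundedLT
    (fun S : Set V => ∀ q, (∀ x ∈ S, proj Γ G x (φ q) = 1) → q = 1)
    ⟨Set.univ, fun q hq => (map_eq_one_iff φ hφ).1
      (eq_one_of_isOfFinOrder_of_proj_eq_one (hfin q) fun x => hq x trivial)⟩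
  refine ⟨S, ?_, hS.prop⟩
  -- By minimality, some element of `Q` has its only nontrivial component in `S` at `v`.
  have hmin : ∀ v ∈ S, ∃ q, (∀ x ∈ S, x ≠ v → proj Γ G x (φ q) = 1) ∧ proj Γ G v (φ q) ≠ 1 := by
    intro v hv
    have := hS.not_prop_of_lt (Set.sdiff_singleton_ssubset.2 hv)
    push Not at this
    obtain ⟨q, hq, hq1⟩ := this
    refine ⟨q, fun x hx hxv => hq x ⟨hx, hxv⟩, fun hqv => hq1 (hS.prop q fun x hx => ?_)⟩
    by_cases hxv : x = v
    · rw [hxv, hqv]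
    · exact hq x ⟨hx, hxv⟩
  intro v hv w hw hvw
  by_contra hadj
  obtain ⟨a, ha, hav⟩ := hmin v hv
  obtain ⟨b, hb, hbw⟩ := hmin w hw
  rcases proj_eq_one_or_proj_eq_one hvw hadj (hfin (a * b)) with h | h
  · rw [map_mul, map_mul, hb v hv hvw, mul_one] at h
    exact hav h
  · rw [map_mul, map_mul, ha w hw hvw.symm, one_mul] at h
    exact hbw h

theorem pairwise_commute_of {Λ : Set V} (hΛ : Γ.IsClique Λ) :
    Pairwise fun x y : Λ => ∀ (a : G x) (b : G y), Commute (of Γ G x a) (of Γ G y b) :=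
  fun x y hxy a b => commute_of (hΛ x.2 y.2 (Subtype.coe_injective.ne hxy)) a b

/-- The homomorphism from the direct product of the vertex groups of a clique to the graph
product. -/
noncomputable def cliqueHom [Finite V] {Λ : Set V} (hΛ : Γ.IsClique Λ) :
    (∀ x : Λ, G x) →* GraphProduct Γ G :=
  letI := Fintype.ofFinite Λ
  MonoidHom.noncommPiCoprod (fun x : Λ => of Γ G x) (pairwise_commute_of hΛ)

theorem cliqueHom_range [Finite V] {Λ : Set V} (hΛ : Γ.IsClique Λ) :
    (cliqueHom (G := G) hΛ).range = vertexSubgroup Γ G Λ := by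
  let := Fintype.ofFinite Λ
  rw [cliqueHom, MonoidHom.noncommPiCoprod_range, vertexSubgroup, iSup_subtype']

theorem proj_cliqueHom [Finite V] {Λ : Set V} (hΛ : Γ.IsClique Λ) (g : ∀ x : Λ, G x) (x : Λ) :
    proj Γ G x (cliqueHom hΛ g) = g x := by
  classical
  let := Fintype.ofFinite Λ
  refine DFunLike.congr_fun (f := (proj Γ G x).comp (cliqueHom hΛ))
    (g := Pi.evalMonoidHom (fun x : Λ => G x) x) (MonoidHom.pi_ext fun y a => ?_) g
  rw [MonoidHom.comp_apply, cliqueHom, MonoidHom.noncommPiCoprod_mulSingle, Pi.evalMonoidHom_apply]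
  rcases eq_or_ne y x with rfl | hyx
  · rw [proj_of_self, Pi.mulSingle_eq_same]
  · rw [proj_of_ne _ _ (Subtype.coe_injective.ne hyx), Pi.mulSingle_eq_of_ne hyx.symm]

theorem finite_vertexSubgroup [Finite V] [∀ x, Finite (G x)] {Λ : Set V} (hΛ : Γ.IsClique Λ) :
    Finite (vertexSubgroup Γ G Λ) := by
  rw [← cliqueHom_range hΛ]
  exact Finite.of_surjective _ (cliqueHom (G := G) hΛ).rangeRestrict_surjective

theorem exists_maximal_clique_injective [Finite V] {Q : Type*} [Group Q] [Finite Q]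
    (φ : Q →* GraphProduct Γ G) (hφ : Function.Injective φ) :
    ∃ Λ : Set V, Maximal Γ.IsClique Λ ∧
      ∃ f : Q →* vertexSubgroup Γ G Λ, Function.Injective f := by
  obtain ⟨S, hS, hinj⟩ := exists_isClique_forall_proj_eq_one φ hφ
  obtain ⟨Λ, hSΛ, hΛ⟩ := Finite.exists_le_maximal hS
  refine ⟨Λ, hΛ, ((cliqueHom hΛ.prop).codRestrict _ fun g => ?_).comp
    (MonoidHom.mk' (fun q (x : Λ) => proj Γ G x (φ q)) fun a b => ?_), ?_⟩
  · rw [← cliqueHom_range hΛ.prop]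
    exact ⟨g, rfl⟩
  · funext x
    simp
  · rw [injective_iff_map_eq_one]
    intro q hq
    refine hinj q fun x hx => ?_
    have h := congrArg (fun t => proj Γ G x t.1) hq
    simpa [proj_cliqueHom hΛ.prop _ ⟨x, hSΛ hx⟩] using
      (proj_cliqueHom hΛ.prop (fun y : Λ => proj Γ G y (φ q)) ⟨x, hSΛ hx⟩).symm.trans h

end Finite

end GraphProduct

theorem mainTheorem2 {V : Type u} [Finite V] (Γ : SimpleGraph V)
    (G : V → Type v) [∀ x, Group (G x)] [∀ x, Finite (G x)]
    (H : V → Type w) [∀ x, Group (H x)] [∀ x, Finite (H x)]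
    (hGH : ∀ Λ Δ : Set V, Maximal Γ.IsClique Λ → Maximal Γ.IsClique Δ →
      IsEmpty (GraphProduct.vertexSubgroup Γ G Λ ≃* GraphProduct.vertexSubgroup Γ H Δ)) :
    IsEmpty (GraphProduct Γ G ≃* GraphProduct Γ H) := by
  refine ⟨fun e => ?_⟩
  obtain ⟨Λ₀, -, hΛ₀⟩ := Finite.exists_le_maximal (p := Γ.IsClique) (a := (∅ : Set V)) (by simp)
  obtain ⟨Λ, hΛ, hmax⟩ := Set.exists_max_image {Λ : Set V | Maximal Γ.IsClique Λ}
    (fun Λ => Nat.card (GraphProduct.vertexSubgroup Γ G Λ)) (Set.toFinite _) ⟨Λ₀, hΛ₀⟩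
  have := GraphProduct.finite_vertexSubgroup (G := G) hΛ.prop
  obtain ⟨Δ, hΔ, f, hf⟩ := GraphProduct.exists_maximal_clique_injective
    (e.toMonoidHom.comp (GraphProduct.vertexSubgroup Γ G Λ).subtype)
    (e.injective.comp Subtype.coe_injective)
  have := GraphProduct.finite_vertexSubgroup (G := H) hΔ.prop
  obtain ⟨Λ', hΛ', f', hf'⟩ := GraphProduct.exists_maximal_clique_injective
    (e.symm.toMonoidHom.comp (GraphProduct.vertexSubgroup Γ H Δ).subtype)
    (e.symm.injective.comp Subtype.coe_injective)
  have := GraphProduct.finite_vertexSubgroup (G := G) hΛ'.prop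
  have hcard : Nat.card (GraphProduct.vertexSubgroup Γ G Λ) =
      Nat.card (GraphProduct.vertexSubgroup Γ H Δ) :=
    le_antisymm (Nat.card_le_card_of_injective f hf)
      ((Nat.card_le_card_of_injective f' hf').trans (hmax Λ' hΛ'))
  exact (hGH Λ Δ hΛ hΔ).false
    (MulEquiv.ofBijective f ((Nat.bijective_iff_injective_and_card f).2 ⟨hf, hcard⟩))
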